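/- Corollary 1 (Cheeger alternative). Let $d\ge 1$ be an integer and $M>0$. Let $G=(V,E)$ be an infinite, locally finite, connected simple graph that is $M$-uniform in dimension $d$, that is: there are closed balls $(B_v)_{v\in V}$ in $\mathbb R^d$ with radii $r_v>0$ and pairwise disjoint interiors such that two distinct vertices $u,v$ are adjacent in $G$ if and only if $B_u$ and $B_v$ are tangent, and $r_u/r_v\le M$ whenever $B_u$ and $B_v$ are tangent. For a finite set $W\subset V$ let $\partial W$ be the set of vertices not in $W$ that have a neighbour in $W$, and let $$\operatorname{Cheeger}(G)=\inf\Big\{\frac{|\partial W|}{|W|} : W\subset V,\ 0<|W|<\infty\Big\}.$$ Then at least one of the following holds: (i) $\operatorname{Cheeger}(G)>0$; or (ii) there are arbitrarily large finite sets $W$ with $|\partial W|\le |W|^{\frac{d-1}{d}+o(1)}$, that is: there are finite sets $W_n\subset V$ with $|W_n|\to\infty$ and real numbers $\varepsilon_n\to 0$ such that $|\partial W_n|\le |W_n|^{\frac{d-1}{d}+\varepsilon_n}$ for all $n$. -/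

import Mathlib

open Filter Topology

/-- A `d`-dimensional sphere packing indexed by `V`: closed balls in `ℝ^d` with centres `center v`
and radii `radius v > 0`, whose interiors (the open balls) are pairwise disjoint. -/
structure BallPacking (d : ℕ) (V : Type*) where
  center : V → EuclideanSpace ℝ (Fin d)
  radius : V → ℝ
  radius_pos : ∀ v, 0 < radius v
  disjoint_interiors : ∀ u v, u ≠ v →
    Disjoint (Metric.ball (center u) (radius u)) (Metric.ball (center v) (radius v))

namespace BallPacking

variable {d : ℕ} {V : Type*}

/-- The balls of `u` and `v` are (externally) tangent: the distance between the centres is the sum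
of the radii. No ball is tangent to itself, since radii are positive. -/
def Tangent (P : BallPacking d V) (u v : V) : Prop :=
  dist (P.center u) (P.center v) = P.radius u + P.radius v

/-- The tangency graph: the vertices are the indices of the balls, and two of them are joined by an
edge if and only if their balls are tangent. -/
def tangencyGraph (P : BallPacking d V) : SimpleGraph V where
  Adj u v := P.Tangent u v
  symm := ⟨fun u v h => by
    unfold Tangent at h ⊢
    rw [dist_comm, h, add_comm]⟩
  loopless := ⟨fun v h => by
    have hv := P.radius_pos v
    unfold Tangent at h
    rw [dist_self] at h
    linarith⟩

/-- A packing is `M`-uniform if the ratio of the radii of any two tangent balls is at most `M`. -/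
def IsUniform (P : BallPacking d V) (M : ℝ) : Prop :=
  ∀ u v, P.Tangent u v → P.radius u / P.radius v ≤ M

end BallPacking

/-- `G` is `M`-uniform in dimension `d`: it is the tangency graph of an `M`-uniform sphere packing
in `ℝ^d`. -/
def IsUniformInDim {V : Type*} (G : SimpleGraph V) (M : ℝ) (d : ℕ) : Prop :=
  ∃ P : BallPacking d V, P.IsUniform M ∧ P.tangencyGraph = G

/-- The outer vertex boundary `∂W`: the vertices not in `W` with a neighbour in `W`. -/
def vertexBoundary {V : Type*} (G : SimpleGraph V) (W : Finset V) : Set V :=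
  {v | v ∉ W ∧ ∃ w ∈ W, G.Adj w v}

/-- The Cheeger constant of an infinite, locally finite graph: the infimum of `|∂W| / |W|` over the
nonempty finite sets `W` of vertices. -/
noncomputable def cheegerConstant {V : Type*} (G : SimpleGraph V) : ℝ :=
  ⨅ W : {W : Finset V // W.Nonempty}, ((vertexBoundary G W.1).ncard : ℝ) / (W.1.card : ℝ)

/-! The engine is a separator (`exists_separator`): any `U` with at least `k ^ d` vertices has a
part `A`, of size between `k ^ d` and `N * k ^ d`, with only `O(k ^ (d - 1))` vertices adjacent to
`U \ A`. To find it, take an almost smallest ball holding `k ^ d` centres. Its double is covered by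
boundedly many balls of half its radius, so holds at most `N * k ^ d` centres. Averaging over `k`
concentric spheres in between, with disjointness of the balls bounding volume, gives a sphere that
few balls approach.

Degrees are at most some `D`, so edge and vertex boundaries are comparable. If for some `k` all sets
of size at most `N * k ^ d` have edge expansion `4DC/k`, peeling separators off any finite set keeps
half of it, and the Cheeger constant is positive. Otherwise each `k` has a violating set `A`. Its
boundary is nonempty, so `|A|` is at least of order `k`; and `|A| ≤ N * k ^ d` turns `|A| / k` into
`O(|A| ^ ((d - 1) / d))`. -/

open MeasureTheory in
/-- Disjoint balls contained in a ball of radius `R`: comparison of volumes. -/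
lemma sum_radius_pow_le {d : ℕ} {ι : Type*} (S : Finset ι) (c : ι → EuclideanSpace ℝ (Fin d))
    (s : ι → ℝ) (hs : ∀ i ∈ S, 0 < s i)
    (hdisj : (S : Set ι).PairwiseDisjoint fun i => Metric.ball (c i) (s i))
    (x : EuclideanSpace ℝ (Fin d)) (R : ℝ) (hR : 0 < R)
    (hsub : ∀ i ∈ S, dist (c i) x + s i ≤ R) : ∑ i ∈ S, s i ^ d ≤ R ^ d := by
  set b := (volume : Measure (EuclideanSpace ℝ (Fin d))) (Metric.ball 0 1) with hb
  have hb0 : b ≠ 0 := (Metric.measure_ball_pos volume _ one_pos).ne'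
  have hbt : b ≠ ⊤ := measure_ball_lt_top.ne
  have hvol : ∀ (y : EuclideanSpace ℝ (Fin d)) (ρ : ℝ), 0 < ρ →
      volume (Metric.ball y ρ) = ENNReal.ofReal (ρ ^ d) * b := by
    intro y ρ hρ
    have := Measure.addHaar_ball_of_pos (volume : Measure (EuclideanSpace ℝ (Fin d))) y hρ
    simpa using this
  have h1 : volume (⋃ i ∈ S, Metric.ball (c i) (s i)) ≤ volume (Metric.ball x R) := by
    refine measure_mono (Set.iUnion₂_subset fun i hi => Metric.ball_subset_ball' ?_)
    linarith [hsub i hi]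
  rw [measure_biUnion_finset hdisj fun i _ => measurableSet_ball, hvol x R hR,
    Finset.sum_congr rfl fun i hi => hvol (c i) (s i) (hs i hi), ← Finset.sum_mul,
    ENNReal.mul_le_mul_iff_left hb0 hbt,
    ← ENNReal.ofReal_sum_of_nonneg fun i hi => pow_nonneg (hs i hi).le d] at h1
  exact (ENNReal.ofReal_le_ofReal_iff (pow_nonneg hR.le d)).1 h1

namespace BallPacking

variable {d : ℕ} {V : Type*}

lemma sum_pow_le (P : BallPacking d V) (S : Finset V) (s : V → ℝ) (hs : ∀ v ∈ S, 0 < s v)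
    (hle : ∀ v ∈ S, s v ≤ P.radius v) (x : EuclideanSpace ℝ (Fin d)) (R : ℝ) (hR : 0 < R)
    (hsub : ∀ v ∈ S, dist (P.center v) x + s v ≤ R) : ∑ v ∈ S, s v ^ d ≤ R ^ d := by
  refine sum_radius_pow_le S P.center s hs ?_ x R hR hsub
  intro u hu v hv huv
  exact (P.disjoint_interiors u v huv).mono (Metric.ball_subset_ball (hle u hu))
    (Metric.ball_subset_ball (hle v hv))

lemma center_injective (P : BallPacking d V) : Function.Injective P.center := by
  intro u v h
  by_contra huv
  have := P.disjoint_interiors u v huv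
  rw [← h] at this
  exact Set.disjoint_left.1 this (Metric.mem_ball_self (P.radius_pos u))
    (Metric.mem_ball_self (P.radius_pos v))

/-- The degrees of an `M`-uniform packing are bounded in terms of `M` and `d`. -/
lemma card_le_of_tangent (P : BallPacking d V) {M : ℝ} (hM : 0 < M) (hP : P.IsUniform M)
    (u : V) (S : Finset V) (hS : ∀ v ∈ S, P.Tangent u v) :
    (S.card : ℝ) ≤ ((1 + M + 1 / M) * M) ^ d := by
  have hu := P.radius_pos u
  -- Uniformity makes every neighbour's radius at least this; shrinking all to it turns the volume
  -- bound into a count.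
  set s := P.radius u / M with hs
  have hspos : 0 < s := div_pos hu hM
  have h := P.sum_pow_le S (fun _ => s) (fun _ _ => hspos) (fun v hv => ?_) (P.center u)
    ((1 + M + 1 / M) * P.radius u) (by positivity) (fun v hv => ?_)
  · rw [Finset.sum_const, nsmul_eq_mul] at h
    have h2 : ((1 + M + 1 / M) * P.radius u) ^ d = ((1 + M + 1 / M) * M) ^ d * s ^ d := by
      rw [← mul_pow, hs]
      congr 1
      field_simp
    rw [h2] at h
    exact le_of_mul_le_mul_right h (pow_pos hspos d)
  · have := hP u v (hS v hv)
    rw [div_le_iff₀ (P.radius_pos v)] at this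
    rw [hs, div_le_iff₀ hM]
    linarith
  · have h1 : dist (P.center u) (P.center v) = P.radius u + P.radius v := hS v hv
    have h2 := hP v u (by unfold Tangent; rw [dist_comm, h1, add_comm])
    rw [div_le_iff₀ hu] at h2
    rw [dist_comm, h1, hs]
    have : (1 + M + 1 / M) * P.radius u = P.radius u + M * P.radius u + P.radius u / M := by
      field_simp
    linarith

end BallPacking

/-! ### Critical balls and covering -/

/-- The infimum of the admissible radii is positive and need not be attained: any admissible radius
below twice the infimum works. -/
lemma exists_not_half {p : ℝ → Prop} {R δ : ℝ} (hδ : 0 < δ) (hR : p R) (hp : ∀ r, p r → δ ≤ r) :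
    ∃ r, 0 < r ∧ p r ∧ ¬ p (r / 2) := by
  have hbdd : BddBelow {r | p r} := ⟨δ, hp⟩
  have hpos : δ ≤ sInf {r | p r} := le_csInf ⟨R, hR⟩ hp
  obtain ⟨r, hr, hlt⟩ := exists_lt_of_csInf_lt (s := {r | p r}) ⟨R, hR⟩
    (show sInf {r | p r} < 2 * sInf {r | p r} by linarith)
  refine ⟨r, hδ.trans_le (hp r hr), hr, fun h => ?_⟩
  have := csInf_le hbdd h
  linarith

/-- A ball containing at least `m` points of a finite set, while no ball of half its radius does. -/
lemma exists_critical_ball {E V : Type*} [PseudoMetricSpace E] (c : V → E) (U : Finset V)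
    (hc : ∀ u ∈ U, ∀ v ∈ U, u ≠ v → 0 < dist (c u) (c v)) {m : ℕ} (hm : 2 ≤ m) (hU : m ≤ U.card) :
    ∃ (x : E) (r : ℝ), 0 < r ∧ m ≤ (U.filter fun u => dist (c u) x ≤ r).card ∧
      ∀ y, (U.filter fun u => dist (c u) y ≤ r / 2).card < m := by
  classical
  obtain ⟨u₀, hu₀⟩ : U.Nonempty := Finset.card_pos.1 (by omega)
  obtain ⟨δ, hδ, hsep⟩ : ∃ δ > 0, ∀ u ∈ U, ∀ v ∈ U, u ≠ v → δ ≤ dist (c u) (c v) := by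
    obtain ⟨a, ha, b, hb, hab⟩ := Finset.one_lt_card.1 (show 1 < U.card by omega)
    obtain ⟨q, hq, hmin⟩ := Finset.exists_min_image U.offDiag
      (fun q => dist (c q.1) (c q.2)) ⟨(a, b), by simp [ha, hb, hab]⟩
    rw [Finset.mem_offDiag] at hq
    exact ⟨_, hc _ hq.1 _ hq.2.1 hq.2.2,
      fun u hu v hv huv => hmin (u, v) (by simp [hu, hv, huv])⟩
  obtain ⟨w, -, hw⟩ := Finset.exists_max_image U (fun u => dist (c u) (c u₀)) ⟨u₀, hu₀⟩
  obtain ⟨r, hr, ⟨x, hx⟩, hnot⟩ := exists_not_half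
    (p := fun r => ∃ x, m ≤ (U.filter fun u => dist (c u) x ≤ r).card)
    (R := dist (c w) (c u₀)) (half_pos hδ)
    ⟨c u₀, by rwa [Finset.filter_true_of_mem hw]⟩ (by
      rintro r ⟨x, hx⟩
      obtain ⟨a, ha, b, hb, hab⟩ := Finset.one_lt_card.1 (lt_of_lt_of_le (by omega) hx)
      rw [Finset.mem_filter] at ha hb
      have h1 := hsep a ha.1 b hb.1 hab
      have h2 := dist_triangle_right (c a) (c b) x
      linarith)
  push Not at hnot
  exact ⟨x, r, hr, hx, hnot⟩

/-- Compactness, after rescaling: `N` depends on `d` alone, as a ball of radius 2 is covered by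
finitely many of radius 1/2. -/
lemma exists_card_filter_dist_le (d : ℕ) : ∃ N : ℕ, 1 ≤ N ∧ ∀ {V : Type*}
    (c : V → EuclideanSpace ℝ (Fin d)) (U : Finset V) (m : ℕ) (r : ℝ), 0 < r →
    (∀ y, (U.filter fun u => dist (c u) y ≤ r / 2).card < m) →
    ∀ x, (U.filter fun u => dist (c u) x ≤ 2 * r).card ≤ N * m := by
  classical
  obtain ⟨t, -, ht, hcov⟩ := (isCompact_closedBall (0 : EuclideanSpace ℝ (Fin d)) 2).finite_cover_balls
    (show (0 : ℝ) < 1 / 2 by norm_num)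
  refine ⟨ht.toFinset.card + 1, by omega, ?_⟩
  intro V c U m r hr hsmall x
  have hsub : (U.filter fun u => dist (c u) x ≤ 2 * r) ⊆
      ht.toFinset.biUnion fun z => U.filter fun u => dist (c u) (x + r • z) ≤ r / 2 := by
    intro u hu
    rw [Finset.mem_filter] at hu
    have hmem : r⁻¹ • (c u - x) ∈ Metric.closedBall (0 : EuclideanSpace ℝ (Fin d)) 2 := by
      rw [mem_closedBall_zero_iff, norm_smul, norm_inv, Real.norm_of_nonneg hr.le, ← dist_eq_norm,
        inv_mul_le_iff₀ hr]
      linarith [hu.2]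
    obtain ⟨z, hz, hlt⟩ := Set.mem_iUnion₂.1 (hcov hmem)
    rw [Finset.mem_biUnion]
    refine ⟨z, ht.mem_toFinset.2 hz, Finset.mem_filter.2 ⟨hu.1, ?_⟩⟩
    have heq : c u - (x + r • z) = r • (r⁻¹ • (c u - x) - z) := by
      rw [smul_sub, smul_smul, mul_inv_cancel₀ hr.ne', one_smul]
      abel
    rw [Metric.mem_ball, dist_eq_norm] at hlt
    rw [dist_eq_norm, heq, norm_smul, Real.norm_of_nonneg hr.le]
    nlinarith
  calc _ ≤ _ := Finset.card_le_card hsub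
    _ ≤ ht.toFinset.card * m := Finset.card_biUnion_le_card_mul _ _ _ fun z _ => (hsmall _).le
    _ ≤ _ := Nat.mul_le_mul_right _ (by omega)

lemma card_filter_natCast_mem_Ico_le (s : Finset ℕ) (α : ℝ) {β : ℝ} (hβ : 0 ≤ β) :
    ((s.filter fun i : ℕ => α ≤ i ∧ (i : ℝ) < α + β).card : ℝ) ≤ β + 1 := by
  have h1 : (s.filter fun i : ℕ => α ≤ i ∧ (i : ℝ) < α + β).card ≤
      (Finset.Ico ⌈α⌉ ⌈α + β⌉).card := by
    refine Finset.card_le_card_of_injOn (fun i : ℕ => (i : ℤ)) ?_ (Nat.cast_injective.injOn)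
    intro i hi
    have hi := (Finset.mem_filter.1 hi).2
    simp only [Finset.coe_Ico, Set.mem_Ico]
    exact ⟨Int.ceil_le.2 (by exact_mod_cast hi.1), Int.lt_ceil.2 (by exact_mod_cast hi.2)⟩
  rw [Int.card_Ico] at h1
  have h2 : ((⌈α + β⌉ - ⌈α⌉).toNat : ℝ) = (⌈α + β⌉ : ℝ) - ⌈α⌉ := by
    have : ⌈α⌉ ≤ ⌈α + β⌉ := Int.ceil_le_ceil (by linarith)
    have h := Int.toNat_of_nonneg (sub_nonneg.2 this)
    exact_mod_cast h
  have h3 : ((s.filter fun i : ℕ => α ≤ i ∧ (i : ℝ) < α + β).card : ℝ) ≤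
      ((⌈α + β⌉ - ⌈α⌉).toNat : ℝ) := by exact_mod_cast h1
  linarith [Int.ceil_lt_add_one (α + β), Int.le_ceil α]

/-! ### The geometric separator -/

namespace BallPacking

variable {d : ℕ} {V : Type*}

/-- Among the spheres of radii `r (1 + i / k)`, `i < k`, one has few of the centres that lie inside
it close to it, relative to the radii of their balls. -/
lemma exists_sphere_few_crossing (P : BallPacking d V) (hd : 1 ≤ d) {L : ℝ} (hL : 1 ≤ L)
    {N k : ℕ} (hk : 1 ≤ k) (U : Finset V) (x : EuclideanSpace ℝ (Fin d)) {r : ℝ} (hr : 0 < r)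
    (hU : (U.filter fun u => dist (P.center u) x ≤ 2 * r).card ≤ N * k ^ d) :
    ∃ ρ, r ≤ ρ ∧ ρ ≤ 2 * r ∧
      ((U.filter fun u => dist (P.center u) x ≤ ρ ∧
        ρ < dist (P.center u) x + L * P.radius u).card : ℝ) ≤
          (L * (N + 3 ^ d) + N) * (k : ℝ) ^ (d - 1) := by
  classical
  have hk0 : (0 : ℝ) < k := by exact_mod_cast hk
  set S := U.filter fun u => dist (P.center u) x ≤ 2 * r with hS
  set ρ : ℕ → ℝ := fun i => r * (1 + i / k) with hρ
  set C := L * ((N : ℝ) + 3 ^ d) + N with hC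
  set p : V → ℕ → Prop := fun u i =>
    dist (P.center u) x ≤ ρ i ∧ ρ i < dist (P.center u) x + L * P.radius u with hp
  have hρle : ∀ i ∈ Finset.range k, r ≤ ρ i ∧ ρ i ≤ 2 * r := by
    intro i hi
    have hi : (i : ℝ) ≤ k := by exact_mod_cast (Finset.mem_range.1 hi).le
    have h1 : (i : ℝ) / k ≤ 1 := (div_le_one hk0).2 hi
    have h0 : (0 : ℝ) ≤ i / k := by positivity
    constructor <;> simp only [hρ] <;> nlinarith
  have hsub : ∀ i ∈ Finset.range k, U.filter (fun u => p u i) = S.filter fun u => p u i := by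
    intro i hi
    ext u
    simp only [hS, Finset.mem_filter]
    exact ⟨fun h => ⟨⟨h.1, h.2.1.trans (hρle i hi).2⟩, h.2⟩, fun h => ⟨h.1.1, h.2⟩⟩
  -- Capping radii at `r` keeps the shrunken balls inside radius `3 * r`; larger balls meet at most
  -- all `k` spheres anyway.
  set t : V → ℝ := fun u => min (P.radius u) r / r with ht
  have ht0 : ∀ u, 0 ≤ t u := fun u =>
    div_nonneg (le_min (P.radius_pos u).le hr.le) hr.le
  have hvol : ∑ u ∈ S, t u ^ d ≤ 3 ^ d := by
    have h := P.sum_pow_le S (fun u => min (P.radius u) r)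
      (fun u _ => lt_min (P.radius_pos u) hr) (fun u _ => min_le_left _ _) x (3 * r)
      (by positivity) (fun u hu => by
        have h1 := (Finset.mem_filter.1 hu).2
        have h2 := min_le_right (P.radius u) r
        linarith)
    simp only [ht, div_pow]
    rw [← Finset.sum_div, div_le_iff₀ (pow_pos hr d), ← mul_pow]
    exact h
  have hcount : ∀ u ∈ S, (((Finset.range k).filter fun i => p u i).card : ℝ) ≤
      L * (1 + (k * t u) ^ d) + 1 := by
    intro u _
    have h1 : (((Finset.range k).filter fun i => p u i).card : ℝ) ≤ L * (k * t u) + 1 := by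
      rcases le_total r (P.radius u) with h | h
      · have : t u = 1 := by simp only [ht]; rw [min_eq_right h, div_self hr.ne']
        rw [this]
        have h2 : (((Finset.range k).filter fun i => p u i).card : ℝ) ≤ k := by
          exact_mod_cast (Finset.card_filter_le _ _).trans (Finset.card_range k).le
        nlinarith
      · have htu : t u = P.radius u / r := by simp only [ht]; rw [min_eq_left h]
        have h3 := card_filter_natCast_mem_Ico_le (Finset.range k)
          (k * (dist (P.center u) x / r - 1)) (β := L * (k * t u))
          (mul_nonneg (by linarith) (mul_nonneg hk0.le (ht0 u)))
        refine le_trans ?_ h3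
        refine Nat.cast_le.2 (Finset.card_le_card (Finset.monotone_filter_right _ ?_))
        rintro i - ⟨ha, hb⟩
        have key : (i : ℝ) = k * (ρ i / r - 1) := by
          simp only [hρ]
          field_simp
          ring
        constructor
        · rw [key]
          gcongr
        · rw [key, htu]
          have : ρ i / r < (dist (P.center u) x + L * P.radius u) / r := by gcongr
          have h4 : (k : ℝ) * (dist (P.center u) x / r - 1) + L * (k * (P.radius u / r)) =
              k * ((dist (P.center u) x + L * P.radius u) / r - 1) := by ring
          rw [h4]
          gcongr
    -- Trades the linear count for a `d`-th power that the volume bound controls; the 1 is paid for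
    -- by the size of `S`.
    have h2 : k * t u ≤ 1 + (k * t u) ^ d := by
      have h0 : 0 ≤ k * t u := mul_nonneg hk0.le (ht0 u)
      rcases le_total (k * t u) 1 with h | h
      · have := pow_nonneg h0 d
        linarith
      · have := le_self_pow₀ h (show d ≠ 0 by omega)
        linarith
    nlinarith
  have hScard : (S.card : ℝ) ≤ N * (k : ℝ) ^ d := by exact_mod_cast hU
  have htotal : ∑ i ∈ Finset.range k, ((U.filter fun u => p u i).card : ℝ) ≤
      ∑ _i ∈ Finset.range k, C * (k : ℝ) ^ (d - 1) := by
    have hdc : ∑ i ∈ Finset.range k, (S.filter fun u => p u i).card =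
        ∑ u ∈ S, ((Finset.range k).filter fun i => p u i).card :=
      (Finset.sum_card_bipartiteAbove_eq_sum_card_bipartiteBelow
        (s := S) (t := Finset.range k) p).symm
    calc ∑ i ∈ Finset.range k, ((U.filter fun u => p u i).card : ℝ)
        = ∑ i ∈ Finset.range k, ((S.filter fun u => p u i).card : ℝ) :=
          Finset.sum_congr rfl fun i hi => by rw [hsub i hi]
      _ = ∑ u ∈ S, (((Finset.range k).filter fun i => p u i).card : ℝ) := by exact_mod_cast hdc
      _ ≤ ∑ u ∈ S, (L * (1 + (k * t u) ^ d) + 1) := Finset.sum_le_sum hcount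
      _ = (L + 1) * S.card + L * (k : ℝ) ^ d * ∑ u ∈ S, t u ^ d := by
          simp only [mul_add, mul_pow, Finset.sum_add_distrib, Finset.sum_const, nsmul_eq_mul,
            ← Finset.mul_sum]
          ring
      _ ≤ (L + 1) * (N * (k : ℝ) ^ d) + L * (k : ℝ) ^ d * 3 ^ d := by gcongr
      _ = C * (k : ℝ) ^ d := by rw [hC]; ring
      _ = ∑ _i ∈ Finset.range k, C * (k : ℝ) ^ (d - 1) := by
          rw [Finset.sum_const, Finset.card_range, nsmul_eq_mul]
          obtain ⟨e, rfl⟩ : ∃ e, d = e + 1 := ⟨d - 1, by omega⟩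
          rw [Nat.add_sub_cancel, pow_succ]
          ring
  obtain ⟨i, hi, hle⟩ := Finset.exists_le_of_sum_le (Finset.nonempty_range_iff.2 (by omega)) htotal
  refine ⟨ρ i, (hρle i hi).1, (hρle i hi).2, ?_⟩
  convert hle using 2

open Classical in
/-- A geometric separator: a large set `U` of vertices of a uniform packing has a subset of size
comparable to `k ^ d` with only `O(k ^ (d - 1))` vertices adjacent to the rest of `U`. -/
lemma exists_separator {V : Type*} (hd : 1 ≤ d) {M : ℝ} (hM : 0 < M) :
    ∃ (N : ℕ) (C : ℝ), 1 ≤ N ∧ 0 < C ∧ ∀ P : BallPacking d V, P.IsUniform M →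
      ∀ k : ℕ, 2 ≤ k → ∀ U : Finset V, k ^ d ≤ U.card →
        ∃ A ⊆ U, k ^ d ≤ A.card ∧ A.card ≤ N * k ^ d ∧
          ((A.filter fun u => ∃ v ∈ U \ A, P.Tangent u v).card : ℝ) ≤ C * (k : ℝ) ^ (d - 1) := by
  obtain ⟨N, hN, hcov⟩ := exists_card_filter_dist_le d
  refine ⟨N, (1 + M) * (N + 3 ^ d) + N, hN, by positivity, ?_⟩
  intro P hP k hk U hU
  obtain ⟨x, r, hr, hmany, hfew⟩ := exists_critical_ball P.center U
    (fun u _ v _ huv => dist_pos.2 fun h => huv (P.center_injective h))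
    (hk.trans (Nat.le_self_pow (by omega) k)) hU
  have h2r := hcov P.center U (k ^ d) r hr hfew x
  -- A neighbour of `u` has radius at most `M` times that of `u`, so its centre is within `1 + M`
  -- radii of the centre of `u`.
  obtain ⟨ρ, h1, h2, hcross⟩ := P.exists_sphere_few_crossing hd (L := 1 + M) (by linarith)
    (by omega : 1 ≤ k) U x hr h2r
  refine ⟨U.filter fun u => dist (P.center u) x ≤ ρ, Finset.filter_subset _ _,
    hmany.trans (Finset.card_le_card (Finset.monotone_filter_right _ fun u _ hu => hu.trans h1)),
    (Finset.card_le_card (Finset.monotone_filter_right _ fun u _ hu => hu.trans h2)).trans h2r, ?_⟩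
  refine le_trans (Nat.cast_le.2 (Finset.card_le_card ?_)) hcross
  intro u hu
  simp only [Finset.mem_filter, Finset.mem_sdiff, not_and, not_le] at hu
  obtain ⟨⟨huU, hux⟩, v, ⟨hvU, hv⟩, huv⟩ := hu
  refine Finset.mem_filter.2 ⟨huU, hux, ?_⟩
  have hdist : dist (P.center v) (P.center u) = P.radius v + P.radius u := by
    rw [dist_comm, add_comm]; exact huv
  have hrad := hP v u hdist
  rw [div_le_iff₀ (P.radius_pos u)] at hrad
  have := dist_triangle (P.center v) (P.center u) x
  have := hv hvU
  nlinarith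

end BallPacking

/-! ### Edge boundaries and peeling -/

section EdgeBoundary

variable {V : Type*} [DecidableEq V]

/-- The number of edges between a finite set and its complement, where `nb v` is the finite set of
neighbours of `v`. -/
def edgeBoundaryCard (nb : V → Finset V) (A : Finset V) : ℕ := ∑ a ∈ A, (nb a \ A).card

/-- Edges between `A` and `U \ A` count once from each side; all other boundary edges leave `U`. -/
lemma edgeBoundaryCard_add {nb : V → Finset V} (hsymm : ∀ u v, v ∈ nb u ↔ u ∈ nb v)
    {A U : Finset V} (hAU : A ⊆ U) :
    edgeBoundaryCard nb A + edgeBoundaryCard nb (U \ A) =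
      edgeBoundaryCard nb U + 2 * ∑ a ∈ A, (nb a ∩ (U \ A)).card := by
  have hswap : ∑ a ∈ A, (nb a ∩ (U \ A)).card = ∑ b ∈ U \ A, (nb b ∩ A).card := by
    have h := Finset.sum_card_bipartiteAbove_eq_sum_card_bipartiteBelow
      (s := A) (t := U \ A) (fun a b => b ∈ nb a)
    convert h using 3 with a _ b _
    · ext b; simp [Finset.bipartiteAbove, and_comm]
    · ext a; simp [Finset.bipartiteBelow, and_comm, hsymm b a]
  have h1 : edgeBoundaryCard nb A = ∑ a ∈ A, ((nb a \ U).card + (nb a ∩ (U \ A)).card) := by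
    refine Finset.sum_congr rfl fun a _ => ?_
    rw [← Finset.card_union_of_disjoint]
    · congr 1
      ext v
      have := @hAU v
      simp only [Finset.mem_sdiff, Finset.mem_union, Finset.mem_inter]
      tauto
    · rw [Finset.disjoint_left]
      intro v
      simp only [Finset.mem_sdiff, Finset.mem_inter]
      tauto
  have h2 : edgeBoundaryCard nb (U \ A) = ∑ b ∈ U \ A, ((nb b \ U).card + (nb b ∩ A).card) := by
    refine Finset.sum_congr rfl fun a _ => ?_
    rw [← Finset.card_union_of_disjoint]
    · congr 1
      ext v
      have := @hAU v
      simp only [Finset.mem_sdiff, Finset.mem_union, Finset.mem_inter]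
      tauto
    · rw [Finset.disjoint_left]
      intro v
      have := @hAU v
      simp only [Finset.mem_sdiff, Finset.mem_inter]
      tauto
  have h3 : edgeBoundaryCard nb U =
      ∑ b ∈ U \ A, (nb b \ U).card + ∑ a ∈ A, (nb a \ U).card :=
    (Finset.sum_sdiff hAU).symm
  rw [h1, h2, h3, Finset.sum_add_distrib, Finset.sum_add_distrib, ← hswap]
  ring

/-- If every large set can be cut into two parts, one of them small, with few edges in between, then
edge expansion of small sets implies edge expansion of all finite sets. -/
lemma mul_card_le_edgeBoundaryCard {nb : V → Finset V} (hsymm : ∀ u v, v ∈ nb u ↔ u ∈ nb v)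
    {m n : ℕ} (hm : 0 < m) (hmn : m ≤ n) {κ : ℝ}
    (hcut : ∀ U : Finset V, m ≤ U.card → ∃ A ⊆ U, m ≤ A.card ∧ A.card ≤ n ∧
      ((∑ a ∈ A, (nb a ∩ (U \ A)).card : ℕ) : ℝ) ≤ κ / 4 * A.card)
    (hsmall : ∀ A : Finset V, A.Nonempty → A.card ≤ n →
      κ * A.card ≤ (edgeBoundaryCard nb A : ℝ)) (hκ : 0 ≤ κ) (U : Finset V) :
    κ / 2 * U.card ≤ (edgeBoundaryCard nb U : ℝ) := by
  induction U using Finset.strongInduction with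
  | H U ih =>
    rcases lt_or_ge U.card m with h | h
    · rcases U.eq_empty_or_nonempty with rfl | hne
      · simp
      · have h1 := hsmall U hne (by omega)
        have : 0 ≤ κ * U.card := by positivity
        linarith
    · obtain ⟨A, hAU, hmA, hAn, hA⟩ := hcut U h
      have hne : A.Nonempty := Finset.card_pos.1 (by omega)
      have h1 := hsmall A hne hAn
      have h2 := ih (U \ A) (Finset.sdiff_ssubset hAU hne)
      -- The cut is subtracted twice, costing at most `κ / 2 * |A|`; half of the expansion of `A`
      -- survives.
      have h3 : (edgeBoundaryCard nb A : ℝ) + edgeBoundaryCard nb (U \ A) =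
          edgeBoundaryCard nb U + 2 * ((∑ a ∈ A, (nb a ∩ (U \ A)).card : ℕ) : ℝ) := by
        exact_mod_cast edgeBoundaryCard_add hsymm hAU
      have h4 : ((U \ A).card : ℝ) + A.card = U.card := by
        exact_mod_cast Finset.card_sdiff_add_card_eq_card hAU
      rw [← h4]
      linarith

end EdgeBoundary

/-! ### Vertex versus edge boundary -/

section VertexBoundary

variable {V : Type*} {G : SimpleGraph V}

lemma vertexBoundary_nonempty [Infinite V] (hconn : G.Connected) {W : Finset V}
    (hW : W.Nonempty) : (vertexBoundary G W).Nonempty := by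
  obtain ⟨w, hw⟩ := hW
  obtain ⟨v, hv⟩ := Infinite.exists_notMem_finset W
  obtain ⟨q⟩ := hconn.preconnected w v
  obtain ⟨e, -, h1, h2⟩ := q.exists_boundary_dart (W : Set V) (by simpa using hw) (by simpa using hv)
  exact ⟨e.snd, by simpa using h2, e.fst, by simpa using h1, e.adj⟩

variable [DecidableEq V] {nb : V → Finset V}

lemma vertexBoundary_eq_coe (hnb : ∀ u v, v ∈ nb u ↔ G.Adj u v) (W : Finset V) :
    vertexBoundary G W = ((W.biUnion nb \ W : Finset V) : Set V) := by
  ext v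
  simp [vertexBoundary, hnb, and_comm]

lemma ncard_vertexBoundary_le (hnb : ∀ u v, v ∈ nb u ↔ G.Adj u v) (W : Finset V) :
    (vertexBoundary G W).ncard ≤ edgeBoundaryCard nb W := by
  rw [vertexBoundary_eq_coe hnb, Set.ncard_coe_finset]
  have : W.biUnion nb \ W = W.biUnion fun w => nb w \ W := by
    ext v
    simp only [Finset.mem_sdiff, Finset.mem_biUnion]
    tauto
  rw [this]
  exact Finset.card_biUnion_le

/-- Each boundary vertex receives at most `D` edges from `W`. -/
lemma edgeBoundaryCard_le (hnb : ∀ u v, v ∈ nb u ↔ G.Adj u v) {D : ℕ}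
    (hD : ∀ v, (nb v).card ≤ D) (W : Finset V) :
    edgeBoundaryCard nb W ≤ D * (vertexBoundary G W).ncard := by
  rw [vertexBoundary_eq_coe hnb, Set.ncard_coe_finset]
  set B := W.biUnion nb \ W with hB
  have h := Finset.sum_card_bipartiteAbove_eq_sum_card_bipartiteBelow
    (s := W) (t := B) (fun a b => b ∈ nb a)
  have h1 : edgeBoundaryCard nb W =
      ∑ a ∈ W, (Finset.bipartiteAbove (fun a b => b ∈ nb a) B a).card := by
    refine Finset.sum_congr rfl fun a ha => congrArg _ ?_
    ext v
    simp only [hB, Finset.bipartiteAbove, Finset.mem_sdiff, Finset.mem_filter, Finset.mem_biUnion]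
    exact ⟨fun hv => ⟨⟨⟨a, ha, hv.1⟩, hv.2⟩, hv.1⟩, fun hv => ⟨hv.2, hv.1.2⟩⟩
  rw [h1, h, mul_comm]
  refine Finset.sum_le_card_nsmul _ _ _ fun b _ => le_trans (Finset.card_le_card ?_) (hD b)
  intro a ha
  rw [Finset.bipartiteBelow, Finset.mem_filter] at ha
  rw [hnb, G.adj_comm, ← hnb]
  exact ha.2

end VertexBoundary

/-! ### Exponents and the dichotomy -/

/-- A constant `C` is `x` to the power `log C / log x`, which tends to 0. -/
lemma exists_exponent_of_le_const_mul_rpow {x : ℕ → ℕ} (hx : Tendsto x atTop atTop)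
    (hx2 : ∀ n, 2 ≤ x n) {C a : ℝ} (hC : 0 < C) :
    ∃ ε : ℕ → ℝ, Tendsto ε atTop (𝓝 0) ∧ ∀ n, C * (x n : ℝ) ^ a = (x n : ℝ) ^ (a + ε n) := by
  refine ⟨fun n => Real.log C / Real.log (x n), ?_, fun n => ?_⟩
  · exact Tendsto.const_div_atTop
      (Real.tendsto_log_atTop.comp (tendsto_natCast_atTop_atTop.comp hx)) _
  · have h1 : (1 : ℝ) < x n := by exact_mod_cast hx2 n
    have h0 : (0 : ℝ) < x n := by linarith
    rw [Real.rpow_add h0, mul_comm]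
    congr 1
    rw [Real.rpow_def_of_pos h0, mul_div_cancel₀ _ (Real.log_pos h1).ne', Real.exp_log hC]

lemma div_le_mul_rpow_of_le_mul_pow {d : ℕ} (hd : 1 ≤ d) {N k a : ℕ} (hk : 1 ≤ k) (ha : 1 ≤ a)
    (hN : 1 ≤ N) (h : a ≤ N * k ^ d) :
    (a : ℝ) / k ≤ N * (a : ℝ) ^ (((d : ℝ) - 1) / d) := by
  have hd0 : (0 : ℝ) < d := by exact_mod_cast hd
  have hk0 : (0 : ℝ) < k := by exact_mod_cast hk
  have ha0 : (0 : ℝ) < a := by exact_mod_cast ha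
  have hroot : (a : ℝ) ^ ((d : ℝ)⁻¹) ≤ N * k := by
    have h1 : (a : ℝ) ≤ ((N : ℝ) * k) ^ d := by
      have : N * k ^ d ≤ (N * k) ^ d := by
        rw [mul_pow]
        exact Nat.mul_le_mul_right _ (Nat.le_self_pow (by omega) N)
      exact_mod_cast h.trans this
    calc (a : ℝ) ^ ((d : ℝ)⁻¹) ≤ (((N : ℝ) * k) ^ d) ^ ((d : ℝ)⁻¹) := by gcongr
      _ = N * k := Real.pow_rpow_inv_natCast (by positivity) (by omega)
  have hsplit : (a : ℝ) = (a : ℝ) ^ (((d : ℝ) - 1) / d) * (a : ℝ) ^ ((d : ℝ)⁻¹) := by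
    rw [← Real.rpow_add ha0]
    have : ((d : ℝ) - 1) / d + (d : ℝ)⁻¹ = 1 := by field_simp; ring
    rw [this, Real.rpow_one]
  rw [div_le_iff₀ hk0]
  calc (a : ℝ) = (a : ℝ) ^ (((d : ℝ) - 1) / d) * (a : ℝ) ^ ((d : ℝ)⁻¹) := hsplit
    _ ≤ (a : ℝ) ^ (((d : ℝ) - 1) / d) * (N * k) := by gcongr
    _ = _ := by ring

lemma cheegerConstant_pos_of_le {V : Type*} [Nonempty V] {G : SimpleGraph V} {κ : ℝ} (hκ : 0 < κ)
    (h : ∀ W : Finset V, W.Nonempty → κ * W.card ≤ ((vertexBoundary G W).ncard : ℝ)) :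
    0 < cheegerConstant G := by
  have : Nonempty {W : Finset V // W.Nonempty} :=
    ⟨⟨{Classical.arbitrary V}, Finset.singleton_nonempty _⟩⟩
  refine hκ.trans_le (le_ciInf fun W => ?_)
  rw [le_div_iff₀ (by exact_mod_cast W.2.card_pos)]
  exact h W.1 W.2

theorem corollary1 {V : Type*} [Infinite V] (G : SimpleGraph V)
    (hfin : ∀ v, (G.neighborSet v).Finite) (hconn : G.Connected)
    (d : ℕ) (hd : 1 ≤ d) (M : ℝ) (hM : 0 < M) (hG : IsUniformInDim G M d) :
    0 < cheegerConstant G ∨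
      ∃ (W : ℕ → Finset V) (ε : ℕ → ℝ),
        Tendsto (fun n => (W n).card) atTop atTop ∧ Tendsto ε atTop (𝓝 0) ∧
        ∀ n, ((vertexBoundary G (W n)).ncard : ℝ) ≤
          ((W n).card : ℝ) ^ (((d : ℝ) - 1) / (d : ℝ) + ε n) := by
  classical
  obtain ⟨P, hP, rfl⟩ := hG
  set nb : V → Finset V := fun v => (hfin v).toFinset with hnbdef
  have hnb : ∀ u v, v ∈ nb u ↔ P.tangencyGraph.Adj u v := by simp [nb]
  have hsymm : ∀ u v, v ∈ nb u ↔ u ∈ nb v := fun u v => by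
    rw [hnb, hnb, SimpleGraph.adj_comm]
  obtain ⟨D, hD1, hD⟩ : ∃ D : ℕ, 1 ≤ D ∧ ∀ v, (nb v).card ≤ D := by
    refine ⟨⌈((1 + M + 1 / M) * M) ^ d⌉₊ + 1, by omega, fun v => Nat.le_succ_of_le ?_⟩
    have := P.card_le_of_tangent hM hP v (nb v) fun w hw => (hnb v w).1 hw
    exact_mod_cast this.trans (Nat.le_ceil _)
  have hD0 : (0 : ℝ) < D := by exact_mod_cast hD1
  obtain ⟨N, C, hN, hC, hsep⟩ := BallPacking.exists_separator (V := V) hd hM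
  -- With `κ = 4DC/k`, the separator cuts at most `D * C * k ^ (d - 1) ≤ κ / 4 * |A|` edges, as
  -- peeling requires.
  by_cases hexp : ∃ k : ℕ, 2 ≤ k ∧ ∀ A : Finset V, A.Nonempty → A.card ≤ N * k ^ d →
      4 * D * C / k * A.card ≤ (edgeBoundaryCard nb A : ℝ)
  · left
    obtain ⟨k, hk, hsmall⟩ := hexp
    have hk0 : (0 : ℝ) < k := by exact_mod_cast (by omega : 0 < k)
    have hκ : 0 < 4 * D * C / k := by positivity
    have hall := mul_card_le_edgeBoundaryCard hsymm (m := k ^ d) (n := N * k ^ d)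
      (by positivity) (Nat.le_mul_of_pos_left _ hN) (κ := 4 * D * C / k) (fun U hU => ?_)
      hsmall hκ.le
    · refine cheegerConstant_pos_of_le (κ := 4 * D * C / k / 2 / D) (by positivity) fun W _ => ?_
      have h1 : (edgeBoundaryCard nb W : ℝ) ≤ D * (vertexBoundary P.tangencyGraph W).ncard := by
        exact_mod_cast edgeBoundaryCard_le hnb hD W
      rw [div_mul_eq_mul_div, div_le_iff₀ hD0]
      exact (hall W).trans (h1.trans_eq (mul_comm _ _))
    · obtain ⟨A, hAU, hkA, hAN, hA⟩ := hsep P hP k hk U hU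
      refine ⟨A, hAU, hkA, hAN, ?_⟩
      set X := A.filter fun u => ∃ v ∈ U \ A, P.Tangent u v with hX
      have h1 : ∑ a ∈ A, (nb a ∩ (U \ A)).card ≤ X.card * D := by
        have hzero : ∀ a ∈ A, a ∉ X → (nb a ∩ (U \ A)).card = 0 := by
          intro a ha haX
          rw [Finset.card_eq_zero, Finset.eq_empty_iff_forall_notMem]
          intro v hv
          rw [Finset.mem_inter] at hv
          exact haX (Finset.mem_filter.2 ⟨ha, v, hv.2, (hnb a v).1 hv.1⟩)
        rw [← Finset.sum_subset (Finset.filter_subset _ A) hzero]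
        exact Finset.sum_le_card_nsmul _ _ _ fun a _ =>
          (Finset.card_le_card Finset.inter_subset_left).trans (hD a)
      have h2 : ((∑ a ∈ A, (nb a ∩ (U \ A)).card : ℕ) : ℝ) ≤ X.card * D := by exact_mod_cast h1
      have h3 : (k : ℝ) ^ (d - 1) * k ≤ A.card := by
        rw [← pow_succ, Nat.sub_add_cancel hd]
        exact_mod_cast hkA
      calc _ ≤ (X.card : ℝ) * D := h2
        _ ≤ C * (k : ℝ) ^ (d - 1) * D := by gcongr
        _ = D * C / k * ((k : ℝ) ^ (d - 1) * k) := by field_simp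
        _ ≤ D * C / k * A.card := by gcongr
        _ = _ := by ring
  · right
    push Not at hexp
    set Q : ℝ := 4 * D * C with hQ
    have hQ0 : 0 < Q := by positivity
    choose! A hAne hAle hAlt using hexp
    -- `K n ≥ Q * (n + 2)` forces `|A (K n)| ≥ n + 2`, since a boundary of size at least 1 gives
    -- `|A| ≥ K n / Q`.
    set K : ℕ → ℕ := fun n => ⌈Q⌉₊ * (n + 2) + 2 with hK
    have hK2 : ∀ n, 2 ≤ K n := fun n => by simp [hK]
    have hbd : ∀ n, 1 ≤ (vertexBoundary P.tangencyGraph (A (K n))).ncard := fun n => by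
      refine (Set.ncard_pos ?_).2 (vertexBoundary_nonempty hconn (hAne _ (hK2 n)))
      rw [vertexBoundary_eq_coe hnb]
      exact Finset.finite_toSet _
    have hle : ∀ n, ((vertexBoundary P.tangencyGraph (A (K n))).ncard : ℝ) ≤
        Q * ((A (K n)).card / K n) := fun n => by
      have h1 : ((vertexBoundary P.tangencyGraph (A (K n))).ncard : ℝ) ≤
          edgeBoundaryCard nb (A (K n)) := by exact_mod_cast ncard_vertexBoundary_le hnb _
      calc _ ≤ _ := h1
        _ ≤ _ := (hAlt _ (hK2 n)).le
        _ = _ := by ring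
    have hcard : ∀ n, n + 2 ≤ (A (K n)).card := fun n => by
      have hK0 : (0 : ℝ) < K n := by exact_mod_cast (by have := hK2 n; omega : 0 < K n)
      have h1 : (1 : ℝ) ≤ Q * ((A (K n)).card / K n) :=
        le_trans (by exact_mod_cast hbd n) (hle n)
      rw [← mul_div_assoc, one_le_div hK0] at h1
      have h2 : Q * ((n : ℝ) + 2) ≤ K n := by
        have := Nat.le_ceil Q
        simp only [hK]
        push_cast
        nlinarith [(Nat.cast_nonneg n : (0 : ℝ) ≤ n)]
      have h3 := le_of_mul_le_mul_left (h2.trans h1) hQ0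
      exact_mod_cast h3
    have htend : Tendsto (fun n => (A (K n)).card) atTop atTop :=
      tendsto_atTop_mono (fun n => (Nat.le_add_right n 2).trans (hcard n)) tendsto_id
    obtain ⟨ε, hε, heq⟩ := exists_exponent_of_le_const_mul_rpow htend
      (fun n => (Nat.le_add_left 2 n).trans (hcard n)) (C := Q * N) (a := ((d : ℝ) - 1) / d)
      (mul_pos hQ0 (by exact_mod_cast hN))
    refine ⟨fun n => A (K n), ε, htend, hε, fun n => ?_⟩
    have := div_le_mul_rpow_of_le_mul_pow hd (by have := hK2 n; omega : 1 ≤ K n)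
      (Finset.card_pos.2 (hAne _ (hK2 n))) hN (hAle _ (hK2 n))
    calc _ ≤ _ := hle n
      _ ≤ Q * (N * ((A (K n)).card : ℝ) ^ (((d : ℝ) - 1) / d)) := by gcongr
      _ = Q * N * ((A (K n)).card : ℝ) ^ (((d : ℝ) - 1) / d) := by ring
      _ = _ := heq n
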